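/- Let $n\ge 1$ be an integer and $b=4n$, and consider the two-letter alphabet $\mathcal A=\{1<b\}$ of integers. For an infinite word $w=w[0]w[1]w[2]\cdots$, let $\Delta(w)=i_0i_1i_2\cdots$ be its run-length encoding, where $i_k$ is the length of the $(k+1)$-th block (maximal factor consisting of a repeated single letter) of $w$. The infinite word $w$ is called smooth over $\mathcal A$ if for every $k\ge 0$ the word $\Delta^k(w)$ is an infinite word all of whose letters lie in $\mathcal A$. An infinite word is called a Lyndon word if it is strictly smaller, in the lexicographic order, than each of its proper suffixes. Then no infinite smooth word over $\mathcal A=\{1<4n\}$ is a Lyndon word. -/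

import Mathlib

/-- An infinite word over a numerical alphabet: `w i` is the letter with index `i` (from `0`). -/
abbrev InfWord : Type := ℕ → ℕ

/-- `w ∈ A^ω`: all letters of the infinite word `w` belong to the alphabet `A`. -/
def InfWord.IsOver (A : Set ℕ) (w : InfWord) : Prop :=
  ∀ i, w i ∈ A

/-- A block (maximal factor of the form `α^k`) of `w` starts at the position `i`. -/
def InfWord.IsBlockStart (w : InfWord) (i : ℕ) : Prop :=
  i = 0 ∨ w i ≠ w (i - 1)

/-- The position at which the `k`-th block of `w` starts (`k = 0, 1, 2, …`). If `w` has at most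
`k` blocks, so that there is no `k`-th one, the value is `0`. -/
noncomputable def InfWord.blockStart (w : InfWord) (k : ℕ) : ℕ :=
  Nat.nth w.IsBlockStart k

/-- The run-length encoding `Δ`: the `k`-th letter of `Δ w` is the length of the `k`-th block of
`w`. When the `k`-th block of `w` does not exist or is infinite, the truncated difference is `0`,
which is not the length of any block and is not a letter of an alphabet of positive integers. So
`Δ w` is over such an alphabet only if `w` has infinitely many blocks, all of them finite. -/
noncomputable def InfWord.runLength (w : InfWord) : InfWord :=
  fun k => w.blockStart (k + 1) - w.blockStart k

/-- Infinite smooth words over an alphabet `A` of positive integers: `Δ^k w ∈ A^ω` for all `k`. -/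
def InfWord.IsSmooth (A : Set ℕ) (w : InfWord) : Prop :=
  ∀ k : ℕ, (InfWord.runLength^[k] w).IsOver A

/-- The suffix of `w` that starts at the position `k`. -/
def InfWord.suffix (w : InfWord) (k : ℕ) : InfWord :=
  fun i => w (k + i)

/-- The strict lexicographic order on infinite words. -/
def InfWord.LexLT (u v : InfWord) : Prop :=
  ∃ k, (∀ i < k, u i = v i) ∧ u k < v k

/-- Infinite Lyndon words: infinite words smaller than all of their proper suffixes. -/
def InfWord.IsLyndon (w : InfWord) : Prop :=
  ∀ k, 0 < k → w.LexLT (w.suffix k)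

/-! Write `b = 4n` and `w_k = Δ^k w`. A position of `w_k` indexes a block of `w_(k-1)`, whose start
is a position there, and so on down; the state of a position is the list of parities of these
positions in `w_k, …, w_1`. Letters alternate between blocks, so these parities decide the letters.
If a position has the state of position `0`, agreement of its suffix with `w_k` passes down to `w`,
and at the first disagreement the Lyndon property prescribes, from the state there, the letter of
the prefix (`BlockTower.tracks_lift`). States evolve by a finite automaton. At the low levels four
equal letters act trivially, so a block of length `4n` leaves the state below it unchanged; this is
where `4 ∣ b` enters.

The rest is a run of this automaton. The first letters of `w_0, …, w_5` must be `1, b, 1, b, b, b`: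
any other choice yields an eventually constant word or a letter that the order forbids. By-products
are the exclusions collected in `BlockTower.constrained`; with them `BlockTower.not_constrained`
refutes every choice of the next first letters. -/

/-- The positions of the blocks in a sequence of words over a two-letter alphabet `{1, 4 * n}`, each
of which is the run-length encoding of the preceding one: `x k j` tells whether the letter with
index `j` of the `k`-th word is `4 * n`, and `S k j` is the start of the `j`-th block of that
word. -/
structure BlockTower (n : ℕ) (x : ℕ → ℕ → Bool) (S : ℕ → ℕ → ℕ) : Prop where
  start_zero : ∀ k, S k 0 = 0
  start_succ : ∀ k j, S k (j + 1) = S k j + if x (k + 1) j then 4 * n else 1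
  letter : ∀ k j i, S k j ≤ i → i < S k (j + 1) → x k i = (x k 0 ^^ j.bodd)

/-! ### Blocks of smooth words and the order on Lyndon words -/

namespace InfWord

variable {u : InfWord}

theorem infinite_isBlockStart (h : ∀ k, 0 < u.runLength k) :
    (Set.ofPred u.IsBlockStart).Infinite := by
  intro hf
  have h1 := h hf.toFinset.card
  -- Past the last block `Nat.nth` returns `0`, which makes the truncated difference vanish.
  have h2 : u.blockStart (hf.toFinset.card + 1) = 0 :=
    Nat.nth_of_card_le hf (Nat.le_succ _)
  simp [runLength, h2] at h1

theorem blockStart_zero : u.blockStart 0 = 0 :=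
  Nat.nth_zero_of_zero (Or.inl rfl)

theorem blockStart_succ (h : ∀ k, 0 < u.runLength k) (k : ℕ) :
    u.blockStart (k + 1) = u.blockStart k + u.runLength k := by
  have := h k
  unfold runLength at *
  omega

theorem eq_of_mem_block (h : ∀ k, 0 < u.runLength k) (j d : ℕ)
    (hd : u.blockStart j + d < u.blockStart (j + 1)) :
    u (u.blockStart j + d) = u (u.blockStart j) := by
  induction d with
  | zero => rfl
  | succ d ih =>
    rw [← ih (by omega)]
    by_contra hne
    have hp : u.IsBlockStart (u.blockStart j + (d + 1)) := Or.inr hne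
    have hlt : Nat.nth u.IsBlockStart j < u.blockStart j + (d + 1) := by
      change u.blockStart j < _
      omega
    obtain ⟨i, hi⟩ := (Nat.range_nth_of_infinite (infinite_isBlockStart h)).symm.subset hp
    rw [← hi] at hlt hd
    have h1 := (Nat.nth_strictMono (infinite_isBlockStart h)).lt_iff_lt.1 hlt
    have h2 := (Nat.nth_strictMono (infinite_isBlockStart h)).lt_iff_lt.1 hd
    omega

theorem ne_of_next_block (h : ∀ k, 0 < u.runLength k) (j : ℕ) :
    u (u.blockStart (j + 1)) ≠ u (u.blockStart j) := by
  have h0 := blockStart_succ h j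
  have h1 := h j
  have h2 : u.IsBlockStart (u.blockStart (j + 1)) :=
    Nat.nth_mem_of_infinite (infinite_isBlockStart h) _
  rcases h2 with h2 | h2
  · omega
  · have h3 : u.blockStart (j + 1) - 1 = u.blockStart j + (u.runLength j - 1) := by omega
    rwa [h3, eq_of_mem_block h j _ (by omega)] at h2

theorem IsSmooth.blockTower {n : ℕ} (hn : 0 < n) {w : InfWord} (hw : w.IsSmooth {1, 4 * n}) :
    BlockTower n (fun k j => decide ((runLength^[k] w) j = 4 * n))
      (fun k => (runLength^[k] w).blockStart) := by
  have hpos : ∀ k j, 0 < (runLength^[k] w).runLength j := by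
    intro k j
    have := hw (k + 1) j
    rw [Function.iterate_succ_apply'] at this
    rcases this with h | h
    · rw [h]; exact one_pos
    · rw [h]; omega
  refine ⟨fun k => blockStart_zero, fun k j => ?_, fun k j i h1 h2 => ?_⟩
  · rw [blockStart_succ (hpos k), Function.iterate_succ_apply']
    have := hw (k + 1) j
    rw [Function.iterate_succ_apply'] at this
    rcases this with h | h
    · rw [h, if_neg]; simp; omega
    · rw [h, if_pos]; simp
  · have hblock : ∀ j, decide ((runLength^[k] w) ((runLength^[k] w).blockStart j) = 4 * n) =
        (decide ((runLength^[k] w) 0 = 4 * n) ^^ j.bodd) := by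
      intro j
      induction j with
      | zero => simp [blockStart_zero]
      | succ j ih =>
        have hne := ne_of_next_block (hpos k) j
        rw [Nat.bodd_succ, Bool.xor_not, ← ih]
        have ha : _ = 1 ∨ _ = 4 * n := hw k ((runLength^[k] w).blockStart j)
        have hb : _ = 1 ∨ _ = 4 * n := hw k ((runLength^[k] w).blockStart (j + 1))
        have h4 : 1 ≠ 4 * n := by omega
        rcases ha with ha | ha <;> rcases hb with hb | hb <;>
          rw [ha, hb] at hne ⊢ <;> simp [h4] at hne ⊢
    obtain ⟨d, rfl⟩ := Nat.exists_eq_add_of_le h1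
    rw [eq_of_mem_block (hpos k) j d h2, hblock]

theorem IsLyndon.exists_lt {n : ℕ} (hn : 0 < n) {w : InfWord} (hw : w.IsOver {1, 4 * n})
    (hl : w.IsLyndon) {j : ℕ} (hj : 0 < j) :
    ∃ m, (∀ i < m, w (j + i) = w i) ∧ w m = 1 ∧ w (j + m) = 4 * n := by
  obtain ⟨m, h1, h2⟩ := hl j hj
  refine ⟨m, fun i hi => (h1 i hi).symm, ?_⟩
  simp only [suffix] at h2
  have ha : w m = 1 ∨ w m = 4 * n := hw m
  have hb : w (j + m) = 1 ∨ w (j + m) = 4 * n := hw (j + m)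
  omega

end InfWord

/-! ### Parity states and their transfer between levels -/

/-- The state of a position `j` of a run-length encoding: the parity of `j`, and the state of the
start of the `j`-th block of the encoded word, where `S` gives the starts of the blocks. -/
def liftState {σ : Type} (S : ℕ → ℕ) (T : ℕ → σ) (j : ℕ) : Bool × σ :=
  (j.bodd, T (S j))

/-- How a letter changes the state `liftState S T`, if `f` tells how a letter changes `T` and
`c` is the first letter of the encoded word. A block of length `4 * n` does not change `T`. -/
def liftStep {σ : Type} (c : Bool) (f : σ → Bool → σ) (s : Bool × σ) (l : Bool) : Bool × σ :=
  (!s.1, if l then s.2 else f s.2 (c ^^ s.1))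

/-- The letter of a run-length encoding that makes the encoded word have the letter `g` where the
next block might start. -/
def liftLeast {σ : Type} (c : Bool) (f : σ → Bool → σ) (g : σ → Bool) (s : Bool × σ) : Bool :=
  g (f s.2 (c ^^ s.1)) == (c ^^ s.1)

/-- The state `T` of the positions of the word `u` changes by `f`, and where `u` first differs from
its suffix starting at a position with the initial state, `u` has the letter given by `g`. -/
structure Tracks {σ : Type} (u : ℕ → Bool) (T : ℕ → σ) (f : σ → Bool → σ) (g : σ → Bool) :
    Prop where
  step : ∀ j, T (j + 1) = f (T j) (u j)
  least : ∀ j m, 0 < j → T j = T 0 → (∀ i < m, u (j + i) = u i) → u (j + m) ≠ u m → u m = g (T m)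

namespace Tracks

variable {σ : Type} {u : ℕ → Bool} {T : ℕ → σ} {f : σ → Bool → σ} {g : σ → Bool}

theorem iterate_four (h : Tracks u T f g) {a b : Bool} {i m : ℕ}
    (hu : ∀ r < 4 * m, u (i + r) = if r.bodd then b else a) :
    T (i + 4 * m) = (fun s => f (f (f (f s a) b) a) b)^[m] (T i) := by
  induction m with
  | zero => rfl
  | succ m ih =>
    rw [Function.iterate_succ_apply', ← ih fun r hr => hu r (by omega)]
    have h0 := hu (4 * m) (by omega)
    have h1 := hu (4 * m + 1) (by omega)
    have h2 := hu (4 * m + 2) (by omega)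
    have h3 := hu (4 * m + 3) (by omega)
    simp [Nat.bodd_mul, ← add_assoc] at h0 h1 h2 h3
    rw [show i + 4 * (m + 1) = i + 4 * m + 3 + 1 by ring, h.step, h3,
      show i + 4 * m + 3 = i + 4 * m + 2 + 1 by ring, h.step, h2,
      show i + 4 * m + 2 = i + 4 * m + 1 + 1 by ring, h.step, h1, h.step, h0]

theorem eq_of_four_fixed (h : Tracks u T f g) {a b : Bool} {i m : ℕ} {s : σ} (hT : T i = s)
    (hu : ∀ r < 4 * m, u (i + r) = if r.bodd then b else a)
    (hs : f (f (f (f s a) b) a) b = s) : T (i + 4 * m) = s := by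
  rw [h.iterate_four hu, hT, Function.iterate_fixed hs]

theorem eq_of_const_fixed (h : Tracks u T f g) {a : Bool} {i m : ℕ} {s : σ} (hT : T i = s)
    (hu : ∀ r < 4 * m, u (i + r) = a)
    (hs : f (f (f (f s a) a) a) a = s) : T (i + 4 * m) = s :=
  h.eq_of_four_fixed hT (fun r hr => by rw [hu r hr, ite_self]) hs

end Tracks

namespace BlockTower

variable {n : ℕ} {x : ℕ → ℕ → Bool} {S : ℕ → ℕ → ℕ}

theorem start_succ_of_false (h : BlockTower n x S) {k j : ℕ} (hx : x (k + 1) j = false) :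
    S k (j + 1) = S k j + 1 := by simp [h.start_succ, hx]

theorem start_succ_of_true (h : BlockTower n x S) {k j : ℕ} (hx : x (k + 1) j = true) :
    S k (j + 1) = S k j + 4 * n := by simp [h.start_succ, hx]

theorem start_lt (h : BlockTower n x S) (hn : 0 < n) (k j : ℕ) : S k j < S k (j + 1) := by
  rw [h.start_succ]; split <;> omega

theorem strictMono (h : BlockTower n x S) (hn : 0 < n) (k : ℕ) : StrictMono (S k) :=
  strictMono_nat_of_lt_succ (h.start_lt hn k)

theorem letter_start (h : BlockTower n x S) (hn : 0 < n) (k j : ℕ) :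
    x k (S k j) = (x k 0 ^^ j.bodd) :=
  h.letter k j _ le_rfl (h.start_lt hn k j)

theorem letter_add (h : BlockTower n x S) {k j r : ℕ} (hx : x (k + 1) j = true)
    (hr : r < 4 * n) : x k (S k j + r) = (x k 0 ^^ j.bodd) :=
  h.letter k j _ (Nat.le_add_right _ _) (by rw [h.start_succ_of_true hx]; omega)

theorem start_add (h : BlockTower n x S) {k j m : ℕ} (hx : ∀ r < m, x (k + 1) (j + r) = false) :
    S k (j + m) = S k j + m := by
  induction m with
  | zero => rfl
  | succ m ih =>
    rw [← add_assoc, h.start_succ_of_false (hx m (by omega)), ih fun r hr => hx r (by omega)]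
    rfl

/-- A run of blocks of length `1` is an alternating factor. -/
theorem letter_alternating (h : BlockTower n x S) (hn : 0 < n) {k j m : ℕ}
    (hx : ∀ r < m, x (k + 1) (j + r) = false) {r : ℕ} (hr : r ≤ m) :
    x k (S k j + r) = (x k 0 ^^ j.bodd ^^ r.bodd) := by
  rw [← h.start_add fun i hi => hx i (by omega), h.letter_start hn, Nat.bodd_add, Bool.xor_assoc]

theorem start_agree (h : BlockTower n x S) {k j m : ℕ}
    (hx : ∀ i < m, x (k + 1) (j + i) = x (k + 1) i) : S k (j + m) = S k j + S k m := by
  induction m with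
  | zero => simp [h.start_zero]
  | succ m ih =>
    rw [← add_assoc, h.start_succ, h.start_succ k m, hx m (by omega),
      ih fun i hi => hx i (by omega), add_assoc]

theorem exists_block (h : BlockTower n x S) {k i m : ℕ} (hi : i < S k m) :
    ∃ r < m, S k r ≤ i ∧ i < S k (r + 1) := by
  induction m with
  | zero => simp [h.start_zero] at hi
  | succ m ih =>
    rcases lt_or_ge i (S k m) with h1 | h1
    · obtain ⟨r, hr, h2⟩ := ih h1
      exact ⟨r, by omega, h2⟩
    · exact ⟨m, by omega, h1, hi⟩

theorem letter_second (h : BlockTower n x S) (hn : 0 < n) (k j : ℕ) :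
    x k (S k j + 1) = (x (k + 1) j == (x k 0 ^^ j.bodd)) := by
  cases hx : x (k + 1) j
  · rw [← h.start_succ_of_false hx, h.letter_start hn, Nat.bodd_succ, Bool.xor_not]
    cases (x k 0 ^^ j.bodd) <;> rfl
  · rw [h.letter_add hx (by omega)]
    cases (x k 0 ^^ j.bodd) <;> rfl

variable {σ : Type} {k : ℕ} {T : ℕ → σ} {f : σ → Bool → σ} {g : σ → Bool}

/-- Equal block lengths give equal blocks below. At the first unequal pair one block has length `1`
and the other `4 * n`, so the words below first differ one position after the block start. `hf`
makes long blocks act trivially. -/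
theorem tracks_lift (h : BlockTower n x S) (hn : 0 < n) (ht : Tracks (x k) T f g)
    {c : Bool} (hc : x k 0 = c) (hf : ∀ s l, f (f (f (f s l) l) l) l = s) :
    Tracks (x (k + 1)) (liftState (S k) T) (liftStep c f) (liftLeast c f g) where
  step j := by
    simp only [liftState, liftStep, Nat.bodd_succ, Prod.mk.injEq, true_and, ← hc]
    cases hx : x (k + 1) j
    · rw [h.start_succ_of_false hx, ht.step, h.letter_start hn]
      rfl
    · rw [h.start_succ_of_true hx]
      exact ht.eq_of_const_fixed rfl (fun r hr => h.letter_add hx hr) (hf _ _)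
  least j m hj hT hag hne := by
    simp only [liftState, Prod.mk.injEq, h.start_zero, Nat.bodd_zero] at hT
    have hSm := h.start_agree hag
    have hodd : ∀ r, (j + r).bodd = r.bodd := by simp [Nat.bodd_add, hT.1]
    have hpos : 0 < S k j := by
      have := h.strictMono hn k hj
      omega
    have key := ht.least (S k j) (S k m + 1) hpos hT.2 ?_ ?_
    · rw [h.letter_second hn, ht.step, h.letter_start hn, hc] at key
      simp only [liftLeast, liftState]
      rw [← key]
      cases x (k + 1) m <;> cases (c ^^ m.bodd) <;> rfl
    · intro i hi
      obtain hi | rfl : i < S k m ∨ i = S k m := by omega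
      · obtain ⟨r, hr, h1, h2⟩ := h.exists_block hi
        have h3 := h.start_agree fun i hi => hag i (lt_trans hi hr)
        have h4 := h.start_agree fun i (hi : i < r + 1) => hag i (by omega)
        rw [h.letter k r i h1 h2, h.letter k (j + r) (S k j + i) (by omega)
          (by rw [add_assoc, h4]; omega), hodd]
      · rw [← hSm, h.letter_start hn, h.letter_start hn, hodd]
    · rw [← add_assoc, ← hSm, h.letter_second hn, h.letter_second hn, hodd]
      revert hne
      cases x (k + 1) m <;> cases x (k + 1) (j + m) <;> cases (x k 0 ^^ m.bodd) <;> simp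

/-- No word of the tower is eventually constant. -/
theorem exists_letter (h : BlockTower n x S) (hn : 0 < n) (k i : ℕ) (l : Bool) :
    ∃ j, i ≤ j ∧ x k j = l := by
  have h1 := (h.strictMono hn k).le_apply (x := i)
  have h2 := h.start_lt hn k i
  by_cases hl : x k (S k i) = l
  · exact ⟨_, h1, hl⟩
  · refine ⟨S k (i + 1), by omega, ?_⟩
    have h3 := h.letter_start hn k i
    have h4 := h.letter_start hn k (i + 1)
    rw [Nat.bodd_succ, Bool.xor_not, ← h3] at h4
    rw [h4]
    revert hl
    cases x k (S k i) <;> cases l <;> simp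

end BlockTower

/-! ### The automata of the first five levels -/

/-- The trivial state. -/
abbrev state0 : ℕ → Unit := fun _ => ()

abbrev state1 (S : ℕ → ℕ → ℕ) : ℕ → Bool × Unit := liftState (S 0) state0
abbrev state2 (S : ℕ → ℕ → ℕ) : ℕ → Bool × Bool × Unit := liftState (S 1) (state1 S)
abbrev state3 (S : ℕ → ℕ → ℕ) : ℕ → Bool × Bool × Bool × Unit := liftState (S 2) (state2 S)
abbrev state4 (S : ℕ → ℕ → ℕ) : ℕ → Bool × Bool × Bool × Bool × Unit :=
  liftState (S 3) (state3 S)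
abbrev state5 (S : ℕ → ℕ → ℕ) : ℕ → Bool × Bool × Bool × Bool × Bool × Unit :=
  liftState (S 4) (state4 S)

abbrev step0 : Unit → Bool → Unit := fun _ _ => ()
abbrev step1 : Bool × Unit → Bool → Bool × Unit := liftStep false step0
abbrev step2 : Bool × Bool × Unit → Bool → Bool × Bool × Unit := liftStep true step1
abbrev step3 (c : Bool) : Bool × Bool × Bool × Unit → Bool → Bool × Bool × Bool × Unit :=
  liftStep c step2
abbrev step4 : Bool × Bool × Bool × Bool × Unit → Bool → Bool × Bool × Bool × Bool × Unit :=
  liftStep true (step3 false)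
abbrev step5 : Bool × Bool × Bool × Bool × Bool × Unit → Bool →
    Bool × Bool × Bool × Bool × Bool × Unit :=
  liftStep true step4

abbrev least0 : Unit → Bool := fun _ => false
abbrev least1 : Bool × Unit → Bool := liftLeast false step0 least0
abbrev least2 : Bool × Bool × Unit → Bool := liftLeast true step1 least1
abbrev least3 (c : Bool) : Bool × Bool × Bool × Unit → Bool := liftLeast c step2 least2
abbrev least4 : Bool × Bool × Bool × Bool × Unit → Bool :=
  liftLeast true (step3 false) (least3 false)
abbrev least5 : Bool × Bool × Bool × Bool × Bool × Unit → Bool := liftLeast true step4 least4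

namespace BlockTower

variable {n : ℕ} {x : ℕ → ℕ → Bool} {S : ℕ → ℕ → ℕ}

theorem letter_one (h : BlockTower n x S) (hn : 0 < n) (k : ℕ) :
    x k 1 = (x (k + 1) 0 == x k 0) := by
  simpa [h.start_zero] using h.letter_second hn k 0

theorem start_one_of_false (h : BlockTower n x S) {k : ℕ} (hx : x (k + 1) 0 = false) :
    S k 1 = 1 := by simpa [h.start_zero] using h.start_succ_of_false hx

theorem start_one_of_true (h : BlockTower n x S) {k : ℕ} (hx : x (k + 1) 0 = true) :
    S k 1 = 4 * n := by simpa [h.start_zero] using h.start_succ_of_true hx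

theorem letter_of_lt (h : BlockTower n x S) {k r : ℕ} (hx : x (k + 1) 0 = true)
    (hr : r < 4 * n) : x k r = x k 0 := by
  simpa [h.start_zero] using h.letter_add hx hr

theorem letter_before (h : BlockTower n x S) (hn : 0 < n) (k j : ℕ) :
    x k (S k (j + 1) - 1) = (x k 0 ^^ j.bodd) := by
  have := h.start_lt hn k j
  exact h.letter k j _ (by omega) (by omega)

theorem tracks1 (h : BlockTower n x S) (hn : 0 < n) (h0 : Tracks (x 0) state0 step0 least0)
    (hx0 : x 0 0 = false) : Tracks (x 1) (state1 S) step1 least1 :=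
  h.tracks_lift hn h0 hx0 (by decide)

theorem tracks2 (h : BlockTower n x S) (hn : 0 < n) (t1 : Tracks (x 1) (state1 S) step1 least1)
    (hx1 : x 1 0 = true) : Tracks (x 2) (state2 S) step2 least2 :=
  h.tracks_lift hn t1 hx1 (by decide)

theorem tracks3 (h : BlockTower n x S) (hn : 0 < n) (t2 : Tracks (x 2) (state2 S) step2 least2)
    {c : Bool} (hx2 : x 2 0 = c) : Tracks (x 3) (state3 S) (step3 c) (least3 c) :=
  h.tracks_lift hn t2 hx2 (by decide)

theorem tracks4 (h : BlockTower n x S) (hn : 0 < n)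
    (t3 : Tracks (x 3) (state3 S) (step3 false) (least3 false))
    (hx3 : x 3 0 = true) : Tracks (x 4) (state4 S) step4 least4 :=
  h.tracks_lift hn t3 hx3 (by decide)

theorem tracks5 (h : BlockTower n x S) (hn : 0 < n) (t4 : Tracks (x 4) (state4 S) step4 least4)
    (hx4 : x 4 0 = true) : Tracks (x 5) (state5 S) step5 least5 :=
  h.tracks_lift hn t4 hx4 (by decide)

/-- A block of length `4 * n` does not change the state. -/
theorem state_block {σ : Type} {k j : ℕ} {c : Bool} {T : ℕ → σ} {f : σ → Bool → σ}
    {g : Bool × σ → Bool} (t : Tracks (x (k + 1)) (liftState (S k) T) (liftStep c f) g)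
    (hx : x (k + 1) j = true) : T (S k (j + 1)) = T (S k j) := by
  have h1 := congrArg Prod.snd (t.step j)
  rwa [hx] at h1

/-! ### The forced first letters -/

theorem first_letter_zero (h : BlockTower n x S) (hn : 0 < n)
    (h0 : Tracks (x 0) state0 step0 least0) : x 0 0 = false := by
  by_contra hx
  obtain ⟨j, hj, hxj⟩ := h.exists_letter hn 0 1 false
  exact hx (h0.least j 0 (by omega) rfl (by simp) (by rw [add_zero, hxj]; exact Ne.symm hx))

/-- Otherwise `w` begins with `1b`, so `11` may not occur later; this forces `w_2` to consist of
`1`s. -/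
theorem first_letter_one (h : BlockTower n x S) (hn : 0 < n)
    (h0 : Tracks (x 0) state0 step0 least0) (hx0 : x 0 0 = false) : x 1 0 = true := by
  by_contra hx
  rw [Bool.not_eq_true] at hx
  have hx01 : x 0 1 = true := by simp [h.letter_one hn, hx, hx0]
  have heven : ∀ i, i.bodd = false → x 1 i = false := by
    intro i hi
    by_contra hxi
    rw [Bool.not_eq_false] at hxi
    have hi0 : 0 < i := by
      rcases Nat.eq_zero_or_pos i with rfl | hi0
      · simp [hx] at hxi
      · exact hi0
    have h1 := h.letter_add (r := 0) hxi (by omega)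
    have h2 := h.letter_add (r := 1) hxi (by omega)
    rw [hi, Bool.xor_false, hx0] at h1 h2
    have hlt := h.strictMono hn 0 hi0
    have := h0.least (S 0 i) 1 (by omega) rfl
      (by intro r hr; obtain rfl : r = 0 := by omega
          rw [h1, hx0]) (by rw [h2, hx01]; simp)
    simp [hx01] at this
  -- A long block of `w_1` would put `b` at an even index: just after itself if it starts at an even
  -- index, inside itself otherwise.
  have hS : ∀ j, S 1 j = j → x 2 j = false := by
    intro j hj
    by_contra hxj
    rw [Bool.not_eq_false] at hxj
    cases hodd : j.bodd
    · have h1 := heven (S 1 (j + 1)) (by rw [h.start_succ_of_true hxj]; simp [hj, hodd])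
      rw [h.letter_start hn] at h1
      simp [hx, hodd] at h1
    · have h1 := heven (S 1 j + 1) (by simp [hj, hodd])
      rw [h.letter_add hxj (by omega)] at h1
      simp [hx, hodd] at h1
  have hS' : ∀ j, S 1 j = j := by
    intro j
    induction j with
    | zero => exact h.start_zero 1
    | succ j ih => rw [h.start_succ_of_false (hS j ih), ih]
  obtain ⟨j, -, hj⟩ := h.exists_letter hn 2 0 true
  simp [hS j (hS' j)] at hj

theorem first_letter_two (h : BlockTower n x S) (hn : 0 < n)
    (t1 : Tracks (x 1) (state1 S) step1 least1) (hx1 : x 1 0 = true) : x 2 0 = false := by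
  by_contra hx
  rw [Bool.not_eq_false] at hx
  have t2 := h.tracks2 hn t1 hx1
  have t3 := h.tracks3 hn t2 hx
  have hx11 : x 1 1 = true := by simp [h.letter_one hn, hx, hx1]
  -- Such a state puts `b1` at a positive even position of `w_1`, against the prefix `bb`.
  have hodd : ∀ j, state2 S j ≠ (true, true, ()) := by
    rintro (_ | j) hj
    · simp [liftState] at hj
    · simp only [liftState, Prod.mk.injEq, and_true, Nat.bodd_succ, Bool.not_eq_true'] at hj
      have h1 := h.start_one_of_true hx
      have h2 := (h.strictMono hn 1).monotone (show 1 ≤ j + 1 by omega)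
      have h3 := h.letter_before hn 1 j
      have h4 := h.letter_start hn 1 (j + 1)
      obtain ⟨i, hi⟩ : ∃ i, S 1 (j + 1) = i + 1 := ⟨S 1 (j + 1) - 1, by omega⟩
      simp [hi, hx1, hj.1] at hj h3 h4
      have := t1.least i 1 (by omega) (by simp [liftState, hj])
        (by intro r hr; obtain rfl : r = 0 := by omega
            rw [add_zero, h3, hx1]) (by rw [h4, hx11]; simp)
      simp [hx11, liftState, liftLeast] at this
  have hnext : ∀ i l, x 2 i = l → step2 (state2 S i) l ≠ (true, true, ()) := by
    rintro i _ rfl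
    rw [← t2.step]
    exact hodd _
  -- A block of length `1` here would lead to the excluded state after two letters; a long block
  -- preserves the state, so `w_3` would end in `bbb…`.
  have hloop : ∀ j, state2 S (S 2 j) = (true, false, ()) → x 3 j = true := by
    intro j hj
    by_contra hxj
    rw [Bool.not_eq_true] at hxj
    have h1 := h.letter_start hn 2 j
    have h2 := h.letter_second hn 2 j
    have h3 := hnext _ _ h2
    rw [t2.step, hj, h1, hx, hxj] at h3
    revert h3
    cases j.bodd <;> decide
  have hx3 : x 3 0 = false := by
    by_contra hx3
    rw [Bool.not_eq_false] at hx3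
    have h1 := state_block t3 hx3
    have h2 := h.letter_start hn 2 1
    rw [h.start_zero, zero_add] at h1
    have h3 := hnext _ _ h2
    rw [hx, h1] at h3
    simp [liftStep, liftState, h.start_zero] at h3
  have hall : ∀ j, state2 S (S 2 (j + 1)) = (true, false, ()) := by
    intro j
    induction j with
    | zero =>
      rw [zero_add, h.start_one_of_false hx3, ← zero_add 1, t2.step, hx]
      simp [liftState, liftStep, h.start_zero]
    | succ j ih => exact (state_block t3 (hloop _ ih)).trans ih
  obtain ⟨j, hj, hxj⟩ := h.exists_letter hn 3 1 false
  obtain ⟨i, rfl⟩ := Nat.exists_eq_add_of_le' hj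
  simp [hloop _ (hall i)] at hxj

theorem first_letter_three (h : BlockTower n x S) (hn : 0 < n)
    (t1 : Tracks (x 1) (state1 S) step1 least1) (hx1 : x 1 0 = true) (hx2 : x 2 0 = false) :
    x 3 0 = true := by
  by_contra hx
  rw [Bool.not_eq_true] at hx
  have t2 := h.tracks2 hn t1 hx1
  have t3 := h.tracks3 hn t2 hx2
  have hx11 : x 1 1 = false := by simp [h.letter_one hn, hx1, hx2]
  have hx21 : x 2 1 = true := by simp [h.letter_one hn, hx2, hx]
  have hS11 := h.start_one_of_false hx2
  have hx12 : x 1 2 = false := by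
    have := h.letter_second hn 1 1
    simpa [hS11, hx1, hx21] using this
  -- Otherwise `b1b` occurs at a positive even position of `w_1`, against the prefix `b11`.
  have hodd : ∀ j, 2 ≤ j → state2 S j = (true, true, ()) → x 2 j = true := by
    intro j hj2 hj
    by_contra hxj
    rw [Bool.not_eq_true] at hxj
    obtain ⟨j, rfl⟩ := Nat.exists_eq_add_of_le' (show 1 ≤ j by omega)
    simp only [liftState, Prod.mk.injEq, and_true, Nat.bodd_succ, Bool.not_eq_true'] at hj
    have h2 := (h.strictMono hn 1) (show 1 < j + 1 by omega)
    have h3 := h.letter_before hn 1 j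
    have h4 := h.letter_start hn 1 (j + 1)
    have h5 := h.letter_start hn 1 (j + 1 + 1)
    rw [h.start_succ_of_false hxj] at h5
    obtain ⟨i, hi⟩ : ∃ i, S 1 (j + 1) = i + 1 := ⟨S 1 (j + 1) - 1, by omega⟩
    simp [hi, hx1, hj.1] at hj h3 h4 h5
    have := t1.least i 2 (by omega) (by simp [liftState, hj])
      (by intro r hr
          obtain rfl | rfl : r = 0 ∨ r = 1 := by omega
          · rw [add_zero, h3, hx1]
          · rw [h4, hx11]) (by rw [hx12]; simpa [add_assoc] using h5)
    simp [hx12, liftState, liftLeast] at this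
  have hzero : state2 S 0 = (false, false, ()) := by simp [liftState, h.start_zero]
  -- `w_2` begins with `1 b^(4n) 1` or `(1b)^(2n) 11`, and its last `1` has the state in which
  -- `hodd` demands `b`.
  cases hx4 : x 4 0
  · have hx31 : x 3 1 = true := by simp [h.letter_one hn, hx, hx4]
    have h1 := state_block t3 hx31
    have h2 := t2.step 0
    have hS21 := h.start_one_of_false hx
    rw [hS21] at h1
    rw [hx2, hzero] at h2
    have h3 := hodd (S 2 2) (by rw [h.start_succ_of_true hx31, hS21]; omega) (h1.trans h2)
    have h4 := h.letter_start hn 2 2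
    simp [h3, hx2] at h4
  · have hrun : ∀ r < 4 * n, x 3 (0 + r) = false := fun r hr => by
      rw [zero_add, h.letter_of_lt hx4 hr, hx]
    have hS2 : S 2 (4 * n) = 4 * n := by
      simpa [h.start_zero] using h.start_add hrun
    have halt : ∀ r < 4 * n, x 2 (0 + r) = if r.bodd then true else false := fun r hr => by
      simpa [h.start_zero, hx2] using h.letter_alternating hn hrun hr.le
    have h1 := t2.eq_of_four_fixed hzero halt rfl
    have hx3b : x 3 (4 * n) = true := by
      have := h.letter_start hn 3 1
      simpa [h.start_one_of_true hx4, hx] using this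
    have h2 := h.letter_add (r := 0) hx3b (by omega)
    have h3 := h.letter_add (r := 1) hx3b (by omega)
    have h4 := t2.step (4 * n)
    simp [hS2, hx2] at h2 h3
    rw [zero_add] at h1
    rw [h2, h1] at h4
    simp [hodd (4 * n + 1) (by omega) h4] at h3

theorem singles (h : BlockTower n x S) (hn : 0 < n) {k : ℕ} (hx1 : x (k + 1) 0 = false)
    (hx2 : x (k + 2) 0 = true) :
    S k (4 * n) = 4 * n ∧ (∀ r ≤ 4 * n, x k r = (x k 0 ^^ r.bodd)) ∧ x (k + 1) (4 * n) = true ∧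
      (∀ r < 4 * n, x k (4 * n + r) = x k 0) ∧ S k (4 * n + 1) = 4 * n + 4 * n ∧
      x k (4 * n + 4 * n) = !x k 0 := by
  have hrun : ∀ r < 4 * n, x (k + 1) (0 + r) = false := fun r hr => by
    rw [zero_add, h.letter_of_lt hx2 hr, hx1]
  have hS : S k (4 * n) = 4 * n := by simpa [h.start_zero] using h.start_add hrun
  have hb : x (k + 1) (4 * n) = true := by
    have := h.letter_start hn (k + 1) 1
    simpa [h.start_one_of_true hx2, hx1] using this
  have hS' : S k (4 * n + 1) = 4 * n + 4 * n := by rw [h.start_succ_of_true hb, hS]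
  refine ⟨hS, fun r hr => ?_, hb, fun r hr => ?_, hS', ?_⟩
  · simpa [h.start_zero] using h.letter_alternating hn hrun hr
  · simpa [hS] using h.letter_add hb hr
  · simpa [hS'] using h.letter_start hn k (4 * n + 1)

theorem state3_zero (h : BlockTower n x S) : state3 S 0 = (false, false, false, ()) := by
  simp [liftState, h.start_zero]

theorem state4_zero (h : BlockTower n x S) : state4 S 0 = (false, false, false, false, ()) := by
  simp [liftState, h.start_zero]

theorem state5_zero (h : BlockTower n x S) :
    state5 S 0 = (false, false, false, false, false, ()) := by
  simp [liftState, h.start_zero]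

theorem first_letter_four (h : BlockTower n x S) (hn : 0 < n)
    (t3 : Tracks (x 3) (state3 S) (step3 false) (least3 false)) (hx3 : x 3 0 = true) :
    x 4 0 = true := by
  by_contra hx
  rw [Bool.not_eq_true] at hx
  have t4 := h.tracks4 hn t3 hx3
  have hx31 : x 3 1 = false := by simp [h.letter_one hn, hx, hx3]
  have hkill3 : ∀ j, 0 < j → state3 S j = (false, false, false, ()) → x 3 j = true →
      x 3 (j + 1) = true → False := by
    intro j hj hT h1 h2
    have := t3.least j 1 hj (hT.trans h.state3_zero.symm)
      (by intro r hr; obtain rfl : r = 0 := by omega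
          rw [add_zero, h1, hx3]) (by rw [h2, hx31]; simp)
    rw [hx31, ← zero_add 1, t3.step, h.state3_zero, hx3] at this
    exact absurd this (by decide)
  -- A long block contains `bb` starting at its first or its second letter, and one of these is in
  -- the initial state, according to `s`.
  have hkill4 : ∀ j s, 0 < j → state4 S j = (false, s, false, false, ()) → x 4 j ≠ true := by
    intro j s hj hT h1
    have hpos : 0 < S 3 j := by
      have := h.strictMono hn 3 hj
      omega
    have hT1 : j.bodd = false := congrArg Prod.fst hT
    have hT2 : state3 S (S 3 j) = (s, false, false, ()) := congrArg Prod.snd hT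
    have hl : ∀ r < 4 * n, x 3 (S 3 j + r) = true := fun r hr => by
      rw [h.letter_add h1 hr, hx3, hT1]; rfl
    have h0 := hl 0 (by omega)
    cases s
    · exact hkill3 _ hpos hT2 h0 (hl 1 (by omega))
    · refine hkill3 (S 3 j + 1) (by omega) ?_ (hl 1 (by omega)) (hl 2 (by omega))
      rw [add_zero] at h0
      rw [t3.step, hT2, h0]
      rfl
  have hT0 := h.state4_zero
  -- `w_4` begins with `1bb`, `(1b)^(2n) 1^(4n) b` or `1^(4n) b`; `hkill4` excludes the last `b`.
  cases hx5 : x 5 0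
  · cases hx6 : x 6 0
    · have hx41 : x 4 1 = true := by simp [h.letter_one hn, hx, hx5]
      have hx51 : x 5 1 = true := by simp [h.letter_one hn, hx5, hx6]
      have hx42 : x 4 2 = true := by
        simpa [h.start_one_of_false hx5, hx] using h.letter_add (r := 1) hx51 (by omega)
      have h1 := t4.step 0
      have h2 := t4.step 1
      rw [hT0, hx] at h1
      rw [h1, hx41] at h2
      exact hkill4 2 _ (by omega) h2 hx42
    · obtain ⟨-, h1, -, h2, -, h3⟩ := h.singles hn hx5 hx6
      have h4 := t4.eq_of_four_fixed (a := false) (b := true) (m := n) hT0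
        (fun r hr => by rw [zero_add, h1 r hr.le, hx]; simp) rfl
      rw [zero_add] at h4
      have h5 := t4.eq_of_const_fixed h4 (fun r hr => h2 r hr) (by rw [hx]; rfl)
      rw [hx] at h3
      exact hkill4 _ _ (by omega) h5 h3
  · have h1 := t4.eq_of_const_fixed (a := false) (m := n) hT0
      (fun r hr => by rw [zero_add, h.letter_of_lt hx5 hr, hx]) rfl
    have h2 := h.letter_start hn 4 1
    rw [h.start_one_of_true hx5, hx] at h2
    rw [zero_add] at h1
    exact hkill4 _ _ (by omega) h1 h2

/-- A `b` here would produce `(b1)^(2n) b1` at a positive even position of `w_1`, whose prefix is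
`(b1)^(2n) bb`; at that odd index the prefix should have `1`. -/
theorem letter_three_eq_false (h : BlockTower n x S) (hn : 0 < n)
    (t1 : Tracks (x 1) (state1 S) step1 least1) (hx1 : x 1 0 = true) (hx2 : x 2 0 = false)
    (hx3 : x 3 0 = true) {j : ℕ} (hj : state3 S j = (false, true, true, ())) :
    x 3 j = false := by
  by_contra hxj
  rw [Bool.not_eq_false] at hxj
  obtain _ | j := j
  · rw [h.state3_zero] at hj
    simp at hj
  simp only [liftState, Prod.mk.injEq, and_true] at hj
  obtain ⟨hj0, hj1, hj2⟩ := hj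
  have hlow := h.start_lt hn 2 j
  obtain ⟨i, hi⟩ : ∃ i, S 2 (j + 1) = i + 1 := ⟨S 2 (j + 1) - 1, by omega⟩
  have h1 := h.letter_before hn 2 j
  have h2 : ∀ r < 4 * n, x 2 (i + 1 + r) = false := fun r hr => by
    rw [← hi, h.letter_add hxj hr, hj0, hx2]; rfl
  simp only [hi, Nat.bodd_succ, Bool.not_eq_true', Bool.not_eq_false',
    Nat.add_sub_cancel] at h1 hj0 hj1 hj2
  rw [hx2, hj0] at h1
  have h3 := h.start_succ_of_true h1
  obtain ⟨p, hp⟩ : ∃ p, S 1 (i + 1) = p + 1 := ⟨S 1 (i + 1) - 1, by omega⟩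
  have h4 := h.letter_before hn 1 i
  simp only [hp, Nat.bodd_succ, Bool.not_eq_true', Nat.add_sub_cancel, hx1, hj1,
    Bool.xor_false] at h4 hj2
  have h5 : ∀ r ≤ 4 * n, x 1 (p + (r + 1)) = r.bodd := fun r hr => by
    have := h.letter_alternating hn h2 hr
    rw [hp, hx1, Nat.bodd_succ, hj1] at this
    rw [show p + (r + 1) = p + 1 + r by ring, this]
    simp
  obtain ⟨-, h6, -, h7, -⟩ := h.singles hn hx2 hx3
  have h8 := h7 1 (by omega)
  have h9 := h5 (4 * n) le_rfl
  have := t1.least p (4 * n + 1) (by omega) (by simp [liftState, hj2]) ?_ (by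
    rw [h8, h9, hx1]; simp)
  · rw [h8, hx1] at this
    simp [liftState, liftLeast] at this
  · rintro (_ | r) hr
    · exact h4.trans hx1.symm
    · rw [h5 r (by omega), h6 _ (by omega), hx1]
      simp

/-! ### Excluded states and the final contradiction -/

/-- The facts on the first words of the tower of an infinite smooth Lyndon word that decide the
remaining cases. -/
structure Constrained (x : ℕ → ℕ → Bool) (S : ℕ → ℕ → ℕ) : Prop where
  tracks : Tracks (x 4) (state4 S) step4 least4
  first : x 4 0 = true
  ne : ∀ j, state4 S j ≠ (false, false, true, true, ())
  letter : ∀ j, state4 S j = (false, true, true, true, ()) → x 4 j = false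

theorem constrained (h : BlockTower n x S) (hn : 0 < n)
    (h0 : Tracks (x 0) state0 step0 least0) : Constrained x S := by
  have t1 := h.tracks1 hn h0 (h.first_letter_zero hn h0)
  have hx1 := h.first_letter_one hn h0 (h.first_letter_zero hn h0)
  have hx2 := h.first_letter_two hn t1 hx1
  have hx3 := h.first_letter_three hn t1 hx1 hx2
  have t3 := h.tracks3 hn (h.tracks2 hn t1 hx1) hx2
  have hkill := fun j => h.letter_three_eq_false hn t1 hx1 hx2 hx3 (j := j)
  refine ⟨h.tracks4 hn t3 hx3, h.first_letter_four hn t3 hx3, fun j hj => ?_, fun j hj => ?_⟩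
  · have hj1 : j.bodd = false := congrArg Prod.fst hj
    have h1 := hkill (S 3 j) (congrArg Prod.snd hj)
    rw [h.letter_start hn, hx3, hj1] at h1
    simp at h1
  · by_contra hxj
    rw [Bool.not_eq_false] at hxj
    have hj1 : j.bodd = false := congrArg Prod.fst hj
    have hj2 : state3 S (S 3 j) = (true, true, true, ()) := congrArg Prod.snd hj
    have h1 := h.letter_add (r := 1) hxj (by omega)
    have h2 := t3.step (S 3 j)
    rw [hx3, hj1] at h1
    rw [hj2, h.letter_start hn, hx3, hj1] at h2
    rw [hkill _ h2] at h1
    simp at h1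

theorem first_letter_five (h : BlockTower n x S) (hn : 0 < n) (hc : Constrained x S) :
    x 5 0 = true := by
  by_contra hx
  rw [Bool.not_eq_true] at hx
  obtain ⟨t4, hx4, -, hkill⟩ := hc
  have t5 := h.tracks5 hn t4 hx4
  have hx41 : x 4 1 = false := by simp [h.letter_one hn, hx, hx4]
  -- The next block of `w_4` would start in the state that demands `1`, although its even index
  -- gives it the letter `b`.
  have hkill5 : ∀ j, state5 S j = (true, true, false, false, false, ()) → x 5 j ≠ false := by
    intro j hj hxj
    have hj1 : j.bodd = true := congrArg Prod.fst hj
    have hj2 : state4 S (S 4 j) = (true, false, false, false, ()) := congrArg Prod.snd hj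
    have h1 := h.letter_start hn 4 (j + 1)
    have h2 := t4.step (S 4 j)
    rw [h.start_succ_of_false hxj, hx4, Nat.bodd_succ, hj1] at h1
    rw [hj2, h.letter_start hn, hx4, hj1] at h2
    rw [hkill _ h2] at h1
    simp at h1
  have h51 := t5.step 0
  rw [h.state5_zero, hx] at h51
  -- `w_5` begins with `1 b^(4n) 1`, `(1b)^(2n) 11` or `11`; the last makes `w_4` begin with `b1b`,
  -- against `hkill`.
  cases hx6 : x 6 0
  · have hx51 : x 5 1 = true := by simp [h.letter_one hn, hx, hx6]
    cases hx7 : x 7 0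
    · have hx61 : x 6 1 = true := by simp [h.letter_one hn, hx6, hx7]
      have hS := h.start_one_of_false hx6
      have h1 := h.start_succ_of_true hx61
      have h2 := h.letter_start hn 5 2
      have h3 := t5.eq_of_const_fixed (a := true) (m := n) h51 (fun r hr => by
        rw [zero_add, ← hS, h.letter_add hx61 hr, hx]; rfl) rfl
      rw [zero_add, ← hS, ← h1] at h3
      exact hkill5 _ h3 (by rw [h2, hx]; rfl)
    · obtain ⟨-, h1, -, h2, -, -⟩ := h.singles hn hx6 hx7
      have h3 := t5.eq_of_four_fixed (a := false) (b := true) (m := n) h.state5_zero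
        (fun r hr => by rw [zero_add, h1 r hr.le, hx]; simp) rfl
      have h4 := h2 0 (by omega)
      have h5 := t5.step (4 * n)
      rw [zero_add] at h3
      rw [add_zero, hx] at h4
      rw [h3, h4] at h5
      exact hkill5 _ h5 ((h2 1 (by omega)).trans hx)
  · have h1 := h.letter_of_lt hx6 (r := 1) (by omega)
    have h2 := h.letter_start hn 4 2
    have h3 := h.start_succ_of_false (h1.trans hx)
    rw [h.start_one_of_false hx] at h3
    have h4 := t4.step 0
    have h5 := t4.step 1
    rw [h.state4_zero, hx4] at h4
    rw [h4, hx41] at h5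
    rw [h3, hx4, hkill _ h5] at h2
    simp at h2

theorem not_constrained (h : BlockTower n x S) (hn : 0 < n) : ¬ Constrained x S := by
  intro hc
  have hx := h.first_letter_five hn hc
  obtain ⟨t4, hx4, hkill4, -⟩ := hc
  have t5 := h.tracks5 hn t4 hx4
  have hT0 := h.state5_zero
  have hkill : ∀ j, 0 < j → state5 S j = (false, false, false, false, false, ()) →
      x 5 j = true := by
    intro j hj hT
    by_contra hxj
    have := t5.least j 0 hj (hT.trans hT0.symm) (by simp) (by rw [add_zero, hx]; exact hxj)
    rw [hx, hT0] at this
    exact absurd this (by decide)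
  cases hx6 : x 6 0
  swap
  · have h1 := t5.eq_of_const_fixed (a := true) (m := n) hT0
      (fun r hr => by rw [zero_add, h.letter_of_lt hx6 hr, hx]) rfl
    have h2 := h.letter_start hn 5 1
    rw [zero_add] at h1
    rw [h.start_one_of_true hx6, hkill _ (by omega) h1, hx] at h2
    simp at h2
  have hS51 := h.start_one_of_false hx6
  have hx51 : x 5 1 = false := by simp [h.letter_one hn, hx, hx6]
  have h51 := t5.step 0
  rw [hT0, hx, zero_add] at h51
  cases hx7 : x 7 0
  · have hx61 : x 6 1 = true := by simp [h.letter_one hn, hx6, hx7]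
    have hrun : ∀ r < 4 * n, x 5 (1 + r) = false := fun r hr => by
      rw [← hS51, h.letter_add hx61 hr, hx]; rfl
    have h52 := t5.step 1
    rw [h51, hx51] at h52
    have hx52 := hrun 1 (by omega)
    have hS52 := h.start_succ_of_true hx61
    rw [hS51] at hS52
    have h5b := t5.eq_of_const_fixed h51 hrun rfl
    have hS61 := h.start_one_of_false hx7
    cases hx8 : x 8 0
    · have hx71 : x 7 1 = true := by simp [h.letter_one hn, hx7, hx8]
      have hS62 := h.start_succ_of_true hx71
      rw [hS61] at hS62
      have hx62 : x 6 (1 + 4 * n) = false := by rw [← hS62, h.letter_start hn, hx6]; rfl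
      -- `w_6` begins with `1 b^(4n) 1`: the long blocks of `w_5` preserve the state until a block
      -- of length `1`.
      have hinv : ∀ r ≤ 4 * n, state5 S (S 5 (1 + r)) =
          (true, false, false, false, false, ()) := by
        intro r hr
        induction r with
        | zero => rw [add_zero, hS51, h51]; rfl
        | succ r ih =>
          have hxr : x 6 (1 + r) = true := by
            rw [← hS61, h.letter_add hx71 (by omega), hx6]; rfl
          have hfix : ∀ l, step5 (step5 (step5 (step5 (true, false, false, false, false, ()) l) l)
            l) l = (true, false, false, false, false, ()) := by decide
          rw [← add_assoc, h.start_succ_of_true hxr]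
          exact t5.eq_of_const_fixed (ih (by omega)) (fun i hi => h.letter_add hxr hi) (hfix _)
      have hlast := hinv (4 * n) le_rfl
      have h1 := h.letter_start hn 5 (1 + 4 * n)
      have h2 := h.letter_start hn 5 (1 + 4 * n + 1)
      have h3 := h.letter_before hn 5 (4 * n)
      rw [h.start_succ_of_false hx62] at h2
      have h4 := h.strictMono hn 5 (show 1 < 1 + 4 * n by omega)
      rw [hS51] at h4
      -- `p` is the `b` just before that short block. Undoing its step gives the initial state, so
      -- `b1b` at `p` meets the prefix `b11`.
      obtain ⟨p, hp⟩ : ∃ p, S 5 (1 + 4 * n) = p + 1 := ⟨S 5 (1 + 4 * n) - 1, by omega⟩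
      rw [add_comm, hp] at h3
      simp only [Nat.add_sub_cancel] at h3
      rw [hp] at hlast h1 h2 h4
      simp [hx] at h1 h2 h3
      have hback : ∀ s, step5 s true = (true, false, false, false, false, ()) →
          s = (false, false, false, false, false, ()) := by
        rintro ⟨a, s⟩ hs
        simpa [liftStep] using hs
      rw [t5.step, h3] at hlast
      have hp0 : 0 < p := by omega
      have := t5.least p 2 hp0 ((hback _ hlast).trans hT0.symm)
        (by intro r hr
            obtain rfl | rfl : r = 0 ∨ r = 1 := by omega
            · rw [add_zero, h3, hx]
            · rw [h1, hx51]) (by rw [hx52, h2]; simp)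
      rw [hx52, h52] at this
      exact absurd this (by decide)
    · have hx71 := (h.letter_of_lt hx8 (r := 1) (by omega)).trans hx7
      have hx62 : x 6 2 = false := by
        have := h.letter_start hn 6 2
        rw [h.start_succ_of_false hx71, hS61, hx6] at this
        exact this
      have h1 := h.letter_start hn 5 2
      have h2 := h.letter_start hn 5 3
      have h3 := t5.step (1 + 4 * n)
      rw [h.start_succ_of_false hx62, hS52, hx] at h2
      rw [hS52, hx] at h1
      rw [h5b, h1] at h3
      rw [hkill _ (by omega) h3] at h2
      simp at h2
  obtain ⟨hSb, halt, hx6b, hrun, hSb', hx52b⟩ := h.singles hn hx6 hx7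
  have h5b := t5.iterate_four (a := true) (b := false) (i := 0) (m := n)
    (fun r hr => by rw [zero_add, halt r hr.le, hx]; cases r.bodd <;> rfl)
  rw [zero_add, hT0] at h5b
  have hcycle : ∀ s, step5 (step5 (step5 (step5 s true) true) true) true = s := by decide
  have h52b := t5.eq_of_const_fixed rfl (fun r hr => (hrun r hr).trans hx) (hcycle _)
  rw [h5b] at h52b
  rw [hx, Bool.not_true] at hx52b
  -- The factor `b1b1`, read twice, restores the initial state, so only the parity of `n` matters;
  -- for even `n` a `1` follows in the initial state.
  rcases Nat.even_or_odd' n with ⟨m, rfl | rfl⟩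
  · rw [Function.iterate_mul, Function.iterate_fixed rfl] at h52b
    simp [hkill _ (by omega) h52b] at hx52b
  rw [Function.iterate_succ_apply', Function.iterate_mul, Function.iterate_fixed rfl] at h52b
  generalize hN : 2 * m + 1 = n at *
  replace h52b : state5 S (4 * n + 4 * n) = (false, false, false, true, false, ()) := h52b
  have hkill5 : ∀ j, state5 S j = (false, false, true, false, true, ()) → x 5 j ≠ false := by
    intro j hj hxj
    have h1 := t5.step j
    rw [hj, hxj] at h1
    have h2 := t4.step (S 4 (j + 1))
    have hj1 : (j + 1).bodd = true := congrArg Prod.fst h1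
    have hj2 : state4 S (S 4 (j + 1)) = (true, true, false, true, ()) := congrArg Prod.snd h1
    rw [hj2, h.letter_start hn, hx4, hj1] at h2
    exact hkill4 _ h2
  -- Two `1`s lead to the state of `hkill5`, where a third is impossible.
  have hthree : ∀ i, state5 S i = (false, false, false, true, false, ()) →
      (∀ r < 4 * n, x 5 (i + r) = false) → False := by
    intro i hi hrun
    have h0 := hrun 0 (by omega)
    have h1 := t5.step i
    have h2 := t5.step (i + 1)
    rw [add_zero] at h0
    rw [hi, h0] at h1
    rw [h1, hrun 1 (by omega)] at h2
    exact hkill5 _ h2 (hrun 2 (by omega))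
  have hS61 := h.start_one_of_true hx7
  cases hx8 : x 8 0
  swap
  · have hx71 := (h.letter_of_lt hx8 (r := 1) (by omega)).trans hx7
    have hx6b' := h.letter_add (r := 1) hx71 (by omega)
    rw [hS61, hx6] at hx6b'
    refine hthree _ h52b fun r hr => ?_
    rw [← hSb', h.letter_add hx6b' hr, hx]
    simp
  have hx71 : x 7 1 = false := by simp [h.letter_one hn, hx7, hx8]
  have hS62 := h.start_succ_of_false hx71
  rw [hS61] at hS62
  -- After `(b1)^(2n) b^(4n)`, `w_5` has either single `1`s separated by long blocks of `b`, which
  -- do not affect the state, or `(1b)^(2n) 1^(4n)`, whose alternating part restores it.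
  cases hx9 : x 9 0
  · have hx81 : x 8 1 = true := by simp [h.letter_one hn, hx8, hx9]
    have h7run : ∀ r < 4 * n, x 7 (1 + r) = false := fun r hr => by
      rw [← h.start_one_of_false hx8, h.letter_add hx81 hr, hx7]; rfl
    have h6 : ∀ r ≤ 4 * n, x 6 (4 * n + r) = !r.bodd := fun r hr => by
      rw [← hS61, h.letter_alternating hn h7run hr, hx6]; simp
    have h61 := h6 1 (by omega)
    have h62 := h6 2 (by omega)
    have h63 := h6 3 (by omega)
    have h64 := h6 4 (by omega)
    have hsingle : ∀ j, x 6 j = false → j.bodd = true →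
        state5 S (S 5 (j + 1)) = step5 (state5 S (S 5 j)) false := by
      intro j hj hodd
      rw [h.start_succ_of_false hj, t5.step, h.letter_start hn, hx, hodd]
      rfl
    have hblock : ∀ j, x 6 j = true → j.bodd = false →
        state5 S (S 5 (j + 1)) = state5 S (S 5 j) := by
      intro j hj hodd
      rw [h.start_succ_of_true hj]
      exact t5.eq_of_const_fixed rfl
        (fun r hr => by rw [h.letter_add hj hr, hx, hodd]; rfl) (hcycle _)
    have h1 := hsingle _ h61 (by simp)
    have h2 := hblock _ h62 (by simp)
    have h3 := hsingle _ h63 (by simp)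
    have h4 := hblock _ h64 (by simp)
    rw [hSb', h52b] at h1
    rw [h2, h1] at h3
    rw [h3] at h4
    refine hkill5 _ h4 ?_
    rw [h.letter_start hn, hx]
    simp
  · obtain ⟨-, h7, -⟩ := h.singles hn hx8 hx9
    have hx72 : x 7 2 = true := by rw [h7 2 (by omega), hx7]; rfl
    have h6 : ∀ r < 4 * n, x 6 (4 * n + 1 + r) = false := fun r hr => by
      rw [← hS62, h.letter_add hx72 hr, hx6]; rfl
    have h63 := h.letter_start hn 6 3
    rw [h.start_succ_of_true hx72, hS62, hx6] at h63
    have h5 := t5.eq_of_four_fixed (a := false) (b := true) (m := n) h52b (fun r hr => by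
      rw [← hSb', h.letter_alternating hn h6 hr.le, hx]; cases r.bodd <;> simp) rfl
    refine hthree _ h5 fun r hr => ?_
    rw [← hSb', ← h.start_add h6, h.letter_add h63 hr, hx]
    simp

end BlockTower

theorem theorem33 (n : ℕ) (hn : 0 < n) :
    ¬ ∃ w : InfWord, w.IsSmooth {1, 4 * n} ∧ w.IsLyndon := by
  rintro ⟨w, hs, hl⟩
  have h := hs.blockTower hn
  have h0 : Tracks (fun j => decide (w j = 4 * n)) state0 step0 least0 := by
    refine ⟨fun _ => rfl, fun j m hj _ hag hne => ?_⟩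
    have hover : w.IsOver {1, 4 * n} := hs 0
    obtain ⟨i, hi, h1, h2⟩ := hl.exists_lt hn hover hj
    have hdec : ∀ a b, decide (w a = 4 * n) = decide (w b = 4 * n) → w a = w b := by
      intro a b hab
      have ha : w a = 1 ∨ w a = 4 * n := hover a
      have hb : w b = 1 ∨ w b = 4 * n := hover b
      rw [decide_eq_decide] at hab
      omega
    have him : i = m := by
      rcases lt_trichotomy i m with him | him | him
      · have := hdec _ _ (hag i him)
        omega
      · exact him
      · exact absurd (by rw [hi m him]) hne
    subst him
    simp only [h1, least0, decide_eq_false_iff_not]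
    omega
  exact h.not_constrained hn (h.constrained hn h0)
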